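/- Let $(W_t)_{0\le t\le 1}$ be a standard Brownian motion on a probability space $(\Omega,\mathcal F,\mathbf P)$, let $f:[0,1]\to\mathbb R$ be integrable and $\delta:[0,1]\to\mathbb R$ square integrable. Let $p>0$ and $A(t,x)=px+B(t,x)$ for $0\le t\le 1$, $x\in\mathbb R$, where $B(\cdot,x)$ is measurable for every $x$, and assume: (C1) $\sup_{0\le t\le 1}\sup_{x\in\mathbb R}|B(t,x)|<\infty$; (C2) the partial derivative $B'_x$ exists on $[0,1]\times\mathbb R$, $\sup_{0\le t\le 1}\sup_{x\in\mathbb R}|B'_x(t,x)|<p$, and $\lim_{h\to 0}\sup_{0\le t\le 1}\sup_{|x-y|\le h}|B'_x(t,x)-B'_x(t,y)|=0$. Then the function $B_0(x)=x+\frac1p\int_0^1 B(s,x)\,ds$ is a bijection of $\mathbb R$ onto $\mathbb R$. Moreover, for all sufficiently small $\varepsilon>0$ let $x^\varepsilon$ be an almost surely continuously differentiable process on $[0,1]$ that satisfies $$d\dot x^\varepsilon(t)=\varepsilon^2\bigl(A(t,x^\varepsilon(t))+f(t)\bigr)\,dt+\varepsilon^2\delta(t)\,dW_t,\qquad 0\le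 t\le 1,$$ together with the Neumann boundary conditions $\dot x^\varepsilon(0)=\dot x^\varepsilon(1)=0$ for all these $\varepsilon$, or with the periodic boundary conditions $x^\varepsilon(0)=x^\varepsilon(1)$, $\dot x^\varepsilon(0)=\dot x^\varepsilon(1)$ for all these $\varepsilon$ (almost surely). Then $$\sup_{0\le t\le 1}|x^\varepsilon(t)-\zeta|\longrightarrow 0\quad\text{in probability as }\varepsilon\to 0+,$$ where $\zeta=B_0^{-1}(\eta)$ and $\eta=-\frac1p\int_0^1 f(s)\,ds-\frac1p\int_0^1\delta(s)\,dW_s$. -/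

import Mathlib

open MeasureTheory ProbabilityTheory Filter Topology Set
open scoped unitInterval ENNReal NNReal

noncomputable section

/-- A standard Brownian motion `(W_t)_{0 ≤ t ≤ 1}` on `(Ω, P)`: it starts at `0`, has independent
increments, `W_t - W_s` has law `N(0, t - s)` for `s ≤ t`, and almost all paths are continuous. -/
structure IsBrownianUnit {Ω : Type*} [MeasurableSpace Ω] (W : I → Ω → ℝ) (P : Measure Ω) :
    Prop where
  zero : ∀ᵐ ω ∂P, W 0 ω = 0
  indep : HasIndepIncrements W P
  law : ∀ s t : I, s ≤ t →
    HasLaw (fun ω => W t ω - W s ω) (gaussianReal 0 (Real.toNNReal ((t : ℝ) - s))) P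
  cont : ∀ᵐ ω ∂P, Continuous (fun t => W t ω)

/-- The left-continuous step function `∑ c_t 1_{(0,t]}` on `[0,1]`. Since
`1_{(a,b]} = 1_{(0,b]} - 1_{(0,a]}`, every linear combination of indicators of intervals
`(a,b] ⊆ [0,1]` is of this form. -/
def stepFun (c : I →₀ ℝ) (s : ℝ) : ℝ :=
  c.sum fun t a => a * (Ioc (0 : ℝ) t).indicator (fun _ => (1 : ℝ)) s

/-- The elementary integral `∫ g dW = ∑ c_t (W_t - W_0)` of the step function
`g = ∑ c_t 1_{(0,t]}`. -/
def stepIntegral {Ω : Type*} (W : I → Ω → ℝ) (c : I →₀ ℝ) (ω : Ω) : ℝ :=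
  c.sum fun t a => a * (W t ω - W 0 ω)

/-- `X` is (a version of) the Wiener integral `∫_0^1 g dW`: it is the limit in `L²(P)` of the
elementary integrals of a sequence of step functions that converges to `g` in `L²[0,1]`. -/
def IsWienerIntegral {Ω : Type*} [MeasurableSpace Ω] (W : I → Ω → ℝ) (P : Measure Ω)
    (g : ℝ → ℝ) (X : Ω → ℝ) : Prop :=
  MemLp X 2 P ∧ ∃ c : ℕ → (I →₀ ℝ),
    Tendsto (fun n => eLpNorm (fun s => stepFun (c n) s - g s) 2 (volume.restrict (Icc 0 1)))
      atTop (𝓝 0) ∧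
    Tendsto (fun n => eLpNorm (fun ω => stepIntegral W (c n) ω - X ω) 2 P) atTop (𝓝 0)

open Classical in
/-- The Wiener integral `∫_0^1 g dW`, a random variable determined up to almost sure equality. -/
def wienerIntegral {Ω : Type*} [MeasurableSpace Ω] (W : I → Ω → ℝ) (P : Measure Ω)
    (g : ℝ → ℝ) : Ω → ℝ :=
  if h : ∃ X, IsWienerIntegral W P g X then h.choose else 0

/-- The indefinite stochastic integral `∫_0^t δ dW`, `0 ≤ t ≤ 1`. -/
def stochInt {Ω : Type*} [MeasurableSpace Ω] (W : I → Ω → ℝ) (P : Measure Ω)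
    (δ : ℝ → ℝ) (t : ℝ) : Ω → ℝ :=
  wienerIntegral W P ((Ioc 0 t).indicator δ)

/-- The linear map sending a family of coefficients to its step function in `L²[0,1]`. -/
def stepLp : (I →₀ ℝ) →ₗ[ℝ] Lp ℝ 2 (volume.restrict (Icc (0 : ℝ) 1)) :=
  Finsupp.linearCombination ℝ fun t : I =>
    indicatorConstLp 2 (measurableSet_Ioc (a := (0 : ℝ)) (b := (t : ℝ)))
      (measure_ne_top (volume.restrict (Icc (0 : ℝ) 1)) _) (1 : ℝ)

theorem coeFn_stepLp (c : I →₀ ℝ) :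
    (stepLp c : ℝ → ℝ) =ᵐ[volume.restrict (Icc (0 : ℝ) 1)] stepFun c := by
  induction c using Finsupp.induction_linear with
  | zero =>
    filter_upwards [Lp.coeFn_zero ℝ 2 (volume.restrict (Icc (0 : ℝ) 1))] with s hs
    rw [map_zero, hs]; simp [stepFun]
  | add c d hc hd =>
    filter_upwards [Lp.coeFn_add (stepLp c) (stepLp d), hc, hd] with s hs h1 h2
    rw [map_add, hs, Pi.add_apply, h1, h2]
    simp only [stepFun]
    rw [Finsupp.sum_add_index' (by simp) (by intros; ring)]
  | single t a =>
    have h : stepLp (Finsupp.single t a) = a • indicatorConstLp 2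
        (measurableSet_Ioc (a := (0 : ℝ)) (b := (t : ℝ)))
        (measure_ne_top (volume.restrict (Icc (0 : ℝ) 1)) _) (1 : ℝ) := by
      simp [stepLp]
    rw [h]
    filter_upwards [Lp.coeFn_smul a (indicatorConstLp 2
        (measurableSet_Ioc (a := (0 : ℝ)) (b := (t : ℝ)))
        (measure_ne_top (volume.restrict (Icc (0 : ℝ) 1)) _) (1 : ℝ)),
      indicatorConstLp_coeFn (p := 2) (hs := measurableSet_Ioc (a := (0 : ℝ)) (b := (t : ℝ)))
        (hμs := measure_ne_top (volume.restrict (Icc (0 : ℝ) 1)) _) (c := (1 : ℝ))] with s h1 h2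
    rw [h1, Pi.smul_apply, h2]
    simp [stepFun]

theorem inner_stepLp_basis (s t : I) :
    inner ℝ (stepLp (Finsupp.single s 1)) (stepLp (Finsupp.single t 1)) = min (s : ℝ) t := by
  have h : ∀ t : I, stepLp (Finsupp.single t 1) = indicatorConstLp 2
        (measurableSet_Ioc (a := (0 : ℝ)) (b := (t : ℝ)))
        (measure_ne_top (volume.restrict (Icc (0 : ℝ) 1)) _) (1 : ℝ) := by
      simp [stepLp]
  rw [h, h, L2.inner_indicatorConstLp_one]
  rw [setIntegral_congr_ae (g := (Ioc (0 : ℝ) t).indicator fun _ => (1 : ℝ)) measurableSet_Ioc]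
  · rw [integral_indicator measurableSet_Ioc]
    simp only [integral_const, smul_eq_mul, mul_one, measureReal_restrict_apply,
      MeasurableSet.univ, univ_inter]
    rw [measureReal_restrict_apply measurableSet_Ioc,
      measureReal_restrict_apply (measurableSet_Ioc.inter measurableSet_Ioc)]
    have : Ioc (0 : ℝ) t ∩ Ioc 0 s ∩ Icc 0 1 = Ioc 0 (min (s : ℝ) t) := by
      ext x
      have := s.2.2
      simp only [mem_inter_iff, mem_Ioc, mem_Icc, le_min_iff]
      constructor
      · tauto
      · rintro ⟨a, b, c⟩
        exact ⟨⟨⟨a, c⟩, a, b⟩, a.le, b.trans this⟩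
    rw [this, measureReal_def, Real.volume_Ioc, ENNReal.toReal_ofReal]
    · simp
    · have := s.2.1; have := t.2.1; simp; tauto
  · filter_upwards [indicatorConstLp_coeFn (p := 2)
      (hs := measurableSet_Ioc (a := (0 : ℝ)) (b := (t : ℝ)))
      (hμs := measure_ne_top (volume.restrict (Icc (0 : ℝ) 1)) _) (c := (1 : ℝ))] with x hx _
    exact hx

theorem denseRange_stepLp : DenseRange stepLp := by
  have : (LinearMap.range stepLp).topologicalClosure = ⊤ := by
    rw [Submodule.topologicalClosure_eq_top_iff, Submodule.eq_bot_iff]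
    intro h hh
    have key : ∀ t : I, ∫ x in Ioc (0 : ℝ) t, h x ∂(volume.restrict (Icc (0 : ℝ) 1)) = 0 := by
      intro t
      rw [← L2.inner_indicatorConstLp_one (𝕜 := ℝ) measurableSet_Ioc
        (measure_ne_top (volume.restrict (Icc (0 : ℝ) 1)) _)]
      refine (Submodule.mem_orthogonal _ _).1 hh _ ⟨Finsupp.single t 1, by simp [stepLp]⟩
    have hint : Integrable h (volume.restrict (Icc (0 : ℝ) 1)) :=
      (Lp.memLp h).integrable (by norm_num)
    have key2 : ∀ s, MeasurableSet s →
        ∫ x in s, h x ∂(volume.restrict (Icc (0 : ℝ) 1)) = 0 := by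
      intro s hs
      induction s, hs using MeasurableSpace.induction_on_inter (borel_eq_generateFrom_Iic ℝ)
        isPiSystem_Iic with
      | empty => simp
      | basic u hu =>
        obtain ⟨a, rfl⟩ := hu
        by_cases ha : a < 0
        · rw [Measure.restrict_restrict measurableSet_Iic]
          have : Iic a ∩ Icc 0 1 = ∅ := by
            ext x; simp only [mem_inter_iff, mem_Iic, mem_Icc, mem_empty_iff_false]; grind
          simp [this]
        · have hm : min a 1 ∈ Icc (0 : ℝ) 1 := ⟨by simpa using ha, min_le_right _ _⟩
          have hk := key ⟨min a 1, hm⟩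
          generalize (h : ℝ → ℝ) = φ at hk ⊢
          rw [Measure.restrict_restrict measurableSet_Ioc] at hk
          rw [Measure.restrict_restrict measurableSet_Iic]
          have h1 : Iic a ∩ Icc (0 : ℝ) 1 = Icc 0 (min a 1) := by
            ext x; simp only [mem_inter_iff, mem_Iic, mem_Icc, le_min_iff]; tauto
          have h2 : Ioc 0 (min a 1) ∩ Icc (0 : ℝ) 1 = Ioc 0 (min a 1) := by
            ext x; simp only [mem_inter_iff, mem_Ioc, mem_Icc, le_min_iff]; grind
          rw [h2] at hk
          rw [h1, integral_Icc_eq_integral_Ioc, hk]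
      | compl u hu ih =>
        have := integral_add_compl hu hint
        have h1 : ∫ x, h x ∂(volume.restrict (Icc (0 : ℝ) 1)) = 0 := by
          have hk := key 1
          clear ih this
          generalize (h : ℝ → ℝ) = φ at hk ⊢
          rw [Measure.restrict_restrict measurableSet_Ioc] at hk
          have h2 : Ioc 0 ((1 : I) : ℝ) ∩ Icc (0 : ℝ) 1 = Ioc 0 1 := by
            ext x; simp only [mem_inter_iff, mem_Ioc, mem_Icc, Icc.coe_one]; grind
          rw [h2] at hk
          rw [integral_Icc_eq_integral_Ioc, hk]
        linarith
      | iUnion f hd hf ih =>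
        rw [integral_iUnion hf hd hint.integrableOn]
        simp [ih]
    have := Integrable.ae_eq_zero_of_forall_setIntegral_eq_zero hint fun s hs _ => key2 s hs
    exact (Lp.eq_zero_iff_ae_eq_zero).2 this
  rw [DenseRange, ← LinearMap.coe_range]
  exact (Submodule.dense_iff_topologicalClosure_eq_top).2 this

section Brownian

variable {Ω : Type*} [MeasurableSpace Ω] {W : I → Ω → ℝ} {P : Measure Ω}

theorem IsBrownianUnit.memLp (hW : IsBrownianUnit W P) (s t : I) (hst : s ≤ t) :
    MemLp (fun ω => W t ω - W s ω) 2 P :=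
  (hW.law s t hst).hasGaussianLaw.memLp_two

/-- The linear map sending a family of coefficients to its elementary integral in `L²(P)`. -/
def stepIntLp (hW : IsBrownianUnit W P) : (I →₀ ℝ) →ₗ[ℝ] Lp ℝ 2 P :=
  Finsupp.linearCombination ℝ fun t : I => (hW.memLp 0 t t.2.1).toLp

theorem coeFn_stepIntLp (hW : IsBrownianUnit W P) (c : I →₀ ℝ) :
    (stepIntLp hW c : Ω → ℝ) =ᵐ[P] stepIntegral W c := by
  induction c using Finsupp.induction_linear with
  | zero =>
    filter_upwards [Lp.coeFn_zero ℝ 2 P] with s hs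
    rw [map_zero, hs]; simp [stepIntegral]
  | add c d hc hd =>
    filter_upwards [Lp.coeFn_add (stepIntLp hW c) (stepIntLp hW d), hc, hd] with s hs h1 h2
    rw [map_add, hs, Pi.add_apply, h1, h2]
    simp only [stepIntegral]
    rw [Finsupp.sum_add_index' (by simp) (by intros; ring)]
  | single t a =>
    have h : stepIntLp hW (Finsupp.single t a) = a • (hW.memLp 0 t t.2.1).toLp := by
      simp [stepIntLp]
    rw [h]
    filter_upwards [Lp.coeFn_smul a (hW.memLp 0 t t.2.1).toLp,
      (hW.memLp 0 t t.2.1).coeFn_toLp] with s h1 h2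
    rw [h1, Pi.smul_apply, h2]
    simp [stepIntegral]

theorem inner_stepIntLp_basis (hW : IsBrownianUnit W P) (s t : I) :
    inner ℝ (stepIntLp hW (Finsupp.single s 1)) (stepIntLp hW (Finsupp.single t 1))
      = min (s : ℝ) t := by
  wlog hst : s ≤ t generalizing s t
  · rw [real_inner_comm, this t s (le_of_not_ge hst), min_comm]
  have h : ∀ t : I, stepIntLp hW (Finsupp.single t 1) = (hW.memLp 0 t t.2.1).toLp := by
    simp [stepIntLp]
  rw [h, h, L2.inner_def, min_eq_left (by exact_mod_cast hst)]
  have e1 : ∫ ω, (W s ω - W 0 ω) * (W s ω - W 0 ω) ∂P = s := by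
    have hl := hW.law 0 s s.2.1
    have := hl.isProbabilityMeasure
    have h0 : P[fun ω => W s ω - W 0 ω] = 0 := by
      rw [hl.integral_eq, integral_id_gaussianReal]
    have hv : Var[fun ω => W s ω - W 0 ω; P] = s := by
      rw [hl.variance_eq, variance_id_gaussianReal]; simp [s.2.1]
    rw [variance_eq_sub (hW.memLp 0 s s.2.1), h0] at hv
    rw [← hv]; simp [pow_two]
  have e2 : ∫ ω, (W s ω - W 0 ω) * (W t ω - W s ω) ∂P = 0 := by
    have hi := hW.indep.indepFun_sub_sub (r := 0) (s := s) (t := t) s.2.1 hst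
    have hl := hW.law s t hst
    have h0 : P[fun ω => W t ω - W s ω] = 0 := by
      rw [hl.integral_eq, integral_id_gaussianReal]
    have := hi.integral_mul_eq_mul_integral (hW.memLp 0 s s.2.1).aestronglyMeasurable
      (hW.memLp s t hst).aestronglyMeasurable
    have h0' : ∫ ω, (W t - W s) ω ∂P = 0 := h0
    rw [h0', mul_zero] at this
    exact this
  have i1 : Integrable (fun ω => (W s ω - W 0 ω) * (W s ω - W 0 ω)) P :=
    (hW.memLp 0 s s.2.1).integrable_mul (hW.memLp 0 s s.2.1)
  have i2 : Integrable (fun ω => (W s ω - W 0 ω) * (W t ω - W s ω)) P :=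
    (hW.memLp 0 s s.2.1).integrable_mul (hW.memLp s t hst)
  have e3 := integral_add i1 i2
  rw [e1, e2, add_zero] at e3
  refine Eq.trans (integral_congr_ae ?_) e3
  filter_upwards [(hW.memLp 0 s s.2.1).coeFn_toLp, (hW.memLp 0 t t.2.1).coeFn_toLp] with ω h1 h2
  rw [h1, h2]
  simp
  ring

theorem norm_stepIntLp (hW : IsBrownianUnit W P) (c : I →₀ ℝ) :
    ‖stepIntLp hW c‖ = ‖stepLp c‖ := by
  have h : ∀ c d : I →₀ ℝ, inner ℝ (stepIntLp hW c) (stepIntLp hW d)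
      = inner ℝ (stepLp c) (stepLp d) := by
    intro c d
    induction c using Finsupp.induction_linear with
    | zero => simp
    | add c c' h1 h2 => rw [map_add, map_add, inner_add_left, inner_add_left, h1, h2]
    | single s a =>
      induction d using Finsupp.induction_linear with
      | zero => simp
      | add d d' h1 h2 => rw [map_add, map_add, inner_add_right, inner_add_right, h1, h2]
      | single t b =>
        rw [← mul_one a, ← mul_one b, ← smul_eq_mul, ← smul_eq_mul, ← Finsupp.smul_single,
          ← Finsupp.smul_single]
        simp only [map_smul, inner_smul_left, inner_smul_right, inner_stepIntLp_basis,
          inner_stepLp_basis]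
  rw [@norm_eq_sqrt_real_inner _ _ _ (stepIntLp hW c), @norm_eq_sqrt_real_inner _ _ _ (stepLp c), h]

theorem eLpNorm_stepFun_sub {g : ℝ → ℝ} (hg : MemLp g 2 (volume.restrict (Icc 0 1)))
    (c : I →₀ ℝ) :
    eLpNorm (fun s => stepFun c s - g s) 2 (volume.restrict (Icc 0 1))
      = ‖stepLp c - hg.toLp‖ₑ := by
  rw [Lp.enorm_def]
  apply eLpNorm_congr_ae
  filter_upwards [Lp.coeFn_sub (stepLp c) hg.toLp, coeFn_stepLp c, hg.coeFn_toLp] with s h1 h2 h3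
  rw [h1, Pi.sub_apply, h2, h3]

theorem eLpNorm_stepIntegral_sub (hW : IsBrownianUnit W P) {X : Ω → ℝ} (hX : MemLp X 2 P)
    (c : I →₀ ℝ) :
    eLpNorm (fun ω => stepIntegral W c ω - X ω) 2 P = ‖stepIntLp hW c - hX.toLp‖ₑ := by
  rw [Lp.enorm_def]
  apply eLpNorm_congr_ae
  filter_upwards [Lp.coeFn_sub (stepIntLp hW c) hX.toLp, coeFn_stepIntLp hW c, hX.coeFn_toLp]
    with s h1 h2 h3
  rw [h1, Pi.sub_apply, h2, h3]

theorem tendsto_enorm_sub_iff {E : Type*} [NormedAddCommGroup E] {u : ℕ → E} {a : E} :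
    Tendsto (fun n => ‖u n - a‖ₑ) atTop (𝓝 0) ↔ Tendsto u atTop (𝓝 a) := by
  rw [tendsto_iff_edist_tendsto_0]
  simp_rw [edist_eq_enorm_sub]

/-- Every square integrable function has a Wiener integral. -/
theorem exists_isWienerIntegral (hW : IsBrownianUnit W P) {g : ℝ → ℝ}
    (hg : MemLp g 2 (volume.restrict (Icc 0 1))) : ∃ X, IsWienerIntegral W P g X := by
  obtain ⟨u, hu, hlim⟩ := mem_closure_iff_seq_limit.1 (denseRange_stepLp hg.toLp)
  choose c hc using hu
  obtain rfl : (fun n => stepLp (c n)) = u := funext hc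
  have hcs : CauchySeq fun n => stepIntLp hW (c n) := by
    have := hlim.cauchySeq
    rw [Metric.cauchySeq_iff] at this ⊢
    intro e he
    obtain ⟨N, hN⟩ := this e he
    refine ⟨N, fun m hm n hn => ?_⟩
    have := hN m hm n hn
    rw [dist_eq_norm, ← map_sub] at this ⊢
    rwa [norm_stepIntLp]
  obtain ⟨X, hX⟩ := cauchySeq_tendsto_of_complete hcs
  refine ⟨X, Lp.memLp X, c, ?_, ?_⟩
  · simp_rw [eLpNorm_stepFun_sub hg]
    exact tendsto_enorm_sub_iff.2 hlim
  · simp_rw [eLpNorm_stepIntegral_sub hW (Lp.memLp X)]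
    rw [tendsto_enorm_sub_iff, Lp.toLp_coeFn]
    exact hX

/-- The Wiener integral is unique up to almost sure equality. -/
theorem IsWienerIntegral.ae_eq (hW : IsBrownianUnit W P) {g : ℝ → ℝ}
    (hg : MemLp g 2 (volume.restrict (Icc 0 1))) {X Y : Ω → ℝ} (hX : IsWienerIntegral W P g X)
    (hY : IsWienerIntegral W P g Y) : X =ᵐ[P] Y := by
  obtain ⟨mX, c, c1, c2⟩ := hX
  obtain ⟨mY, d, d1, d2⟩ := hY
  simp_rw [eLpNorm_stepFun_sub hg] at c1 d1
  simp_rw [eLpNorm_stepIntegral_sub hW mX] at c2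
  simp_rw [eLpNorm_stepIntegral_sub hW mY] at d2
  rw [tendsto_enorm_sub_iff] at c1 c2 d1 d2
  have h1 := (c1.sub d1).norm
  have h2 := (c2.sub d2).norm
  simp_rw [← map_sub, norm_stepIntLp] at h2
  simp_rw [← map_sub] at h1
  have h3 := tendsto_nhds_unique h1 h2
  rw [sub_self, norm_zero, eq_comm, norm_eq_zero, sub_eq_zero] at h3
  exact (mX.toLp_eq_toLp_iff mY).1 h3

theorem isWienerIntegral_wienerIntegral (hW : IsBrownianUnit W P) {g : ℝ → ℝ}
    (hg : MemLp g 2 (volume.restrict (Icc 0 1))) :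
    IsWienerIntegral W P g (wienerIntegral W P g) := by
  have h := exists_isWienerIntegral hW hg
  rw [wienerIntegral, dif_pos h]
  exact h.choose_spec

/-- The restriction to `[0,1]` of a Brownian motion on `[0,∞)` is a Brownian motion on `[0,1]`. -/
theorem isBrownianUnit_of_isBrownianReal {V : ℝ≥0 → Ω → ℝ} (hV : IsBrownianReal V P) :
    IsBrownianUnit (fun t : I => V (unitInterval.toNNReal t)) P where
  zero := by
    have h0 : unitInterval.toNNReal 0 = 0 := by ext; simp
    simpa only [h0] using hV.eval_zero_ae_eq_zero
  indep := fun n t ht => hV.hasIndepIncrements n (fun i => unitInterval.toNNReal (t i))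
    fun i j hij => ht hij
  law s t hst := by
    have := hV.hasLaw_sub (unitInterval.toNNReal t) (unitInterval.toNNReal s)
    have e : Real.toNNReal ((t : ℝ) - s)
        = nndist (unitInterval.toNNReal t).1 (unitInterval.toNNReal s).1 := by
      rw [Real.toNNReal_of_nonneg (by exact sub_nonneg.2 hst)]
      ext
      simp only [NNReal.coe_mk, coe_nndist, NNReal.val_eq_coe, unitInterval.coe_toNNReal]
      rw [Real.dist_eq, abs_of_nonneg (by exact sub_nonneg.2 hst)]
    rw [e]
    exact this
  cont := by
    filter_upwards [hV.cont] with ω h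
    exact h.comp unitInterval.toNNReal_continuous

end Brownian

/-- `A(t,x) = p x + B(t,x)` on `[0,1] × ℝ` with `p > 0` and `B` bounded. -/
structure IsBoundedPerturbation (A B : ℝ → ℝ → ℝ) (p : ℝ) : Prop where
  pos : 0 < p
  decomp : ∀ t ∈ Icc (0 : ℝ) 1, ∀ x, A t x = p * x + B t x
  bounded : ∃ b : ℝ, ∀ t ∈ Icc (0 : ℝ) 1, ∀ x, |B t x| ≤ b

/-- The partial derivative `B'_x` exists on `[0,1] × ℝ`, its supremum is `< p` in absolute value,
and it is continuous in `x`, uniformly over `[0,1] × ℝ`. -/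
structure HasSmallDerivative (B : ℝ → ℝ → ℝ) (p : ℝ) : Prop where
  differentiable : ∀ t ∈ Icc (0 : ℝ) 1, Differentiable ℝ (B t)
  bound : ∃ β < p, ∀ t ∈ Icc (0 : ℝ) 1, ∀ x, |deriv (B t) x| ≤ β
  unifCont : ∀ η > 0, ∃ d > 0, ∀ t ∈ Icc (0 : ℝ) 1, ∀ x y, |x - y| ≤ d →
    |deriv (B t) x - deriv (B t) y| ≤ η

/-- The velocity `ẋ(t)` of a process on `[0,1]` (one-sided at the end points). -/
def velocity {Ω : Type*} (x : ℝ → Ω → ℝ) (t : ℝ) (ω : Ω) : ℝ :=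
  derivWithin (fun s => x s ω) (Icc 0 1) t

/-- `x` is an almost surely continuously differentiable process on `[0,1]` that solves
`dẋ(t) = ε² (A(t, x(t)) + f(t)) dt + ε² δ(t) dW_t`, i.e. for every `t ∈ [0,1]`, almost surely
`ẋ(t) = ẋ(0) + ε² ∫_0^t (A(s, x(s)) + f(s)) ds + ε² ∫_0^t δ dW`.
As all other terms are continuous in `t`, this is the same as the equation holding almost surely
for all `t` with the continuous version of the stochastic integral. -/
structure IsSolution {Ω : Type*} [MeasurableSpace Ω] (W : I → Ω → ℝ) (P : Measure Ω)
    (A : ℝ → ℝ → ℝ) (f δ : ℝ → ℝ) (ε : ℝ) (x : ℝ → Ω → ℝ) : Prop where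
  aemeasurable : ∀ t ∈ Icc (0 : ℝ) 1, AEMeasurable (x t) P
  contDiffOn : ∀ᵐ ω ∂P, ContDiffOn ℝ 1 (fun t => x t ω) (Icc 0 1)
  integrable : ∀ᵐ ω ∂P, IntervalIntegrable (fun s => A s (x s ω) + f s) volume 0 1
  equation : ∀ t ∈ Icc (0 : ℝ) 1, ∀ᵐ ω ∂P,
    velocity x t ω = velocity x 0 ω + ε ^ 2 * (∫ s in (0 : ℝ)..t, (A s (x s ω) + f s))
      + ε ^ 2 * stochInt W P δ t ω

/-- The Neumann boundary conditions `ẋ(0) = ẋ(1) = 0`. -/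
def NeumannBC {Ω : Type*} [MeasurableSpace Ω] (P : Measure Ω) (x : ℝ → Ω → ℝ) : Prop :=
  ∀ᵐ ω ∂P, velocity x 0 ω = 0 ∧ velocity x 1 ω = 0

/-- The periodic boundary conditions `x(0) = x(1)` and `ẋ(0) = ẋ(1)`. -/
def PeriodicBC {Ω : Type*} [MeasurableSpace Ω] (P : Measure Ω) (x : ℝ → Ω → ℝ) : Prop :=
  ∀ᵐ ω ∂P, x 0 ω = x 1 ω ∧ velocity x 0 ω = velocity x 1 ω

/-- The averaged map `B₀(x) = x + (1/p) ∫_0^1 B(s,x) ds`. -/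
def averagedMap (B : ℝ → ℝ → ℝ) (p x : ℝ) : ℝ :=
  x + 1 / p * ∫ s in (0 : ℝ)..1, B s x

/-- `η = -(1/p) ∫_0^1 f(s) ds - (1/p) ∫_0^1 δ(s) dW_s`. -/
def limitDatum {Ω : Type*} [MeasurableSpace Ω] (W : I → Ω → ℝ) (P : Measure Ω)
    (f δ : ℝ → ℝ) (p : ℝ) (ω : Ω) : ℝ :=
  -(1 / p) * (∫ s in (0 : ℝ)..1, f s) - 1 / p * stochInt W P δ 1 ω

/-- `ζ = B₀⁻¹(η)`. -/
def limitConstant {Ω : Type*} [MeasurableSpace Ω] (W : I → Ω → ℝ) (P : Measure Ω)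
    (B : ℝ → ℝ → ℝ) (f δ : ℝ → ℝ) (p : ℝ) (ω : Ω) : ℝ :=
  Function.invFun (averagedMap B p) (limitDatum W P f δ p ω)

/-- The uniform norm on `[0,1]`, with values in `[0,∞]`. -/
def unifNorm (y : ℝ → ℝ) : ℝ≥0∞ := ⨆ t ∈ Icc (0 : ℝ) 1, ‖y t‖ₑ

/-- `|x^ε - ζ|_* → 0` in probability as `ε → 0+`. -/
def TendstoUnifInProb {Ω : Type*} [MeasurableSpace Ω] (P : Measure Ω)
    (x : ℝ → ℝ → Ω → ℝ) (ζ : Ω → ℝ) : Prop :=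
  ∀ r : ℝ, 0 < r → Tendsto
    (fun ε => P {ω | ENNReal.ofReal r ≤ unifNorm fun t => x ε t ω - ζ ω}) (𝓝[>] 0) (𝓝 0)

end

/-! ### The averaged equation and the estimate for a single path. -/

section Averaging

variable {A B : ℝ → ℝ → ℝ} {p β b : ℝ}

/-! Both boundary conditions give the velocity equal end values and a zero: at `0` for Neumann, by
Rolle for periodic. Equal end values make the equation at `t = 1` an exact balance, free of `ε`: `∫
(A(s, x(s)) + f) ds + ∫ δ dW = 0`. The zero makes the whole velocity of order `ε²`, because its
increments are. So `x` oscillates by some `D = O(ε²)`, and freezing it at one value changes the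
balance by at most `(p + β) D`. The frozen balance is the equation `B₀(z) = η` defining `ζ`, and `p
B₀` expands distances by at least `p - β > 0`; hence `|x - ζ| ≤ (p + β) / (p - β) * D`
(`abs_sub_le_of_averaged_eq`, `abs_sub_le_of_integrated_eq`).

The constant in `D = O(ε²)` is random but independent of `ε`: the noise enters only through
`noiseSup`, which is almost surely finite because a solution supplies a continuous version of the
stochastic integral. The error is thus at most `ε² Z` with one fixed real random variable `Z`, and
this tends to `0` in probability. -/

theorem abs_sub_le_of_abs_deriv_le {g : ℝ → ℝ} (hg : Differentiable ℝ g)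
    (hβ : ∀ x, |deriv g x| ≤ β) (x y : ℝ) : |g x - g y| ≤ β * |x - y| :=
  convex_univ.norm_image_sub_le_of_norm_deriv_le (fun z _ => hg z) (fun z _ => hβ z)
    (mem_univ y) (mem_univ x)

theorem intervalIntegrable_of_abs_le {g : ℝ → ℝ}
    (hg : AEMeasurable g (volume.restrict (Icc 0 1))) (hb : ∀ t ∈ Icc (0 : ℝ) 1, |g t| ≤ b) :
    IntervalIntegrable g volume 0 1 := by
  rw [intervalIntegrable_iff_integrableOn_Icc_of_le zero_le_one]
  refine Integrable.of_bound hg.aestronglyMeasurable b ?_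
  filter_upwards [ae_restrict_mem measurableSet_Icc] with t ht using hb t ht

theorem abs_integral_le_of_abs_le {g : ℝ → ℝ} (hb : ∀ t ∈ Icc (0 : ℝ) 1, |g t| ≤ b) :
    |∫ t in (0 : ℝ)..1, g t| ≤ b := by
  have := intervalIntegral.norm_integral_le_of_norm_le_const (a := 0) (b := 1) (f := g) (C := b)
    fun t ht => hb t (by rw [uIoc_of_le zero_le_one] at ht; exact Ioc_subset_Icc_self ht)
  simpa using this

theorem mul_averagedMap (hp : p ≠ 0) (x : ℝ) :
    p * averagedMap B p x = p * x + ∫ s in (0 : ℝ)..1, B s x := by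
  rw [averagedMap]; field_simp

/-- The averaged map differs from the identity by a map with Lipschitz constant `β / p`. -/
theorem abs_averagedMap_sub_sub_le (hp : 0 < p)
    (hint : ∀ x, IntervalIntegrable (fun t => B t x) volume 0 1)
    (hlip : ∀ t ∈ Icc (0 : ℝ) 1, ∀ x y, |B t x - B t y| ≤ β * |x - y|) (x y : ℝ) :
    |p * averagedMap B p x - p * averagedMap B p y - p * (x - y)| ≤ β * |x - y| := by
  rw [mul_averagedMap hp.ne', mul_averagedMap hp.ne']
  have := abs_integral_le_of_abs_le fun t ht => hlip t ht x y
  rw [intervalIntegral.integral_sub (hint x) (hint y)] at this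
  convert this using 2
  ring

/-- Quantitative injectivity: it turns a small defect in the averaged equation into a small distance
from its root. -/
theorem sub_mul_abs_sub_le (hp : 0 < p)
    (hint : ∀ x, IntervalIntegrable (fun t => B t x) volume 0 1)
    (hlip : ∀ t ∈ Icc (0 : ℝ) 1, ∀ x y, |B t x - B t y| ≤ β * |x - y|) (x y : ℝ) :
    (p - β) * |x - y| ≤ |p * averagedMap B p x - p * averagedMap B p y| := by
  have h := abs_averagedMap_sub_sub_le hp hint hlip x y
  have h1 := abs_sub_abs_le_abs_sub (p * (x - y))
    (p * averagedMap B p x - p * averagedMap B p y)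
  rw [abs_sub_comm (p * (x - y)), abs_mul, abs_of_pos hp] at h1
  linarith

/-- Injectivity is the expansion bound. Surjectivity is the intermediate value theorem: the map is
continuous and stays within `b / p` of the identity. -/
theorem averagedMap_bijective (hp : 0 < p) (hβp : β < p)
    (hint : ∀ x, IntervalIntegrable (fun t => B t x) volume 0 1)
    (hb : ∀ t ∈ Icc (0 : ℝ) 1, ∀ x, |B t x| ≤ b)
    (hlip : ∀ t ∈ Icc (0 : ℝ) 1, ∀ x y, |B t x - B t y| ≤ β * |x - y|) :
    Function.Bijective (averagedMap B p) := by
  constructor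
  · intro x y hxy
    have := sub_mul_abs_sub_le hp hint hlip x y
    rw [hxy, sub_self, abs_zero] at this
    have h : |x - y| ≤ 0 := by
      by_contra! h
      exact this.not_gt (mul_pos (sub_pos.2 hβp) h)
    exact sub_eq_zero.1 (abs_nonpos_iff.1 h)
  · have hc : Continuous (averagedMap B p) := by
      refine LipschitzWith.continuous (K := Real.toNNReal ((p + β) / p)) ?_
      refine LipschitzWith.of_dist_le' fun x y => ?_
      rw [Real.dist_eq, Real.dist_eq, div_mul_eq_mul_div, le_div_iff₀ hp]
      have h := abs_averagedMap_sub_sub_le hp hint hlip x y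
      have h1 := abs_sub_abs_le_abs_sub (p * averagedMap B p x - p * averagedMap B p y)
        (p * (x - y))
      rw [← mul_sub, abs_mul, abs_mul, abs_of_pos hp, mul_sub] at h1
      linarith
    have hnear : ∀ x, |averagedMap B p x - x| ≤ 1 / p * b := fun x => by
      rw [averagedMap, add_sub_cancel_left, abs_mul, abs_of_pos (one_div_pos.2 hp)]
      exact mul_le_mul_of_nonneg_left (abs_integral_le_of_abs_le fun t ht => hb t ht x)
        (one_div_pos.2 hp).le
    refine hc.surjective ?_ ?_
    · refine tendsto_atTop_mono (fun x => ?_) (tendsto_atTop_add_const_right _ (-(1 / p * b))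
        tendsto_id)
      have := (abs_le.1 (hnear x)).1
      simp only [id]; linarith
    · refine tendsto_atBot_mono (fun x => ?_) (tendsto_atBot_add_const_right _ (1 / p * b)
        tendsto_id)
      have := (abs_le.1 (hnear x)).2
      simp only [id]; linarith

/-- A path of small velocity is close to the root of the averaged equation that it satisfies. -/
theorem abs_sub_le_of_averaged_eq (hp : 0 < p) (hβ : 0 ≤ β) (hβp : β < p)
    (hint : ∀ x, IntervalIntegrable (fun t => B t x) volume 0 1)
    (hlip : ∀ t ∈ Icc (0 : ℝ) 1, ∀ x y, |B t x - B t y| ≤ β * |x - y|)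
    {y : ℝ → ℝ} {D z : ℝ} (hyi : IntervalIntegrable y volume 0 1)
    (hBi : IntervalIntegrable (fun s => B s (y s)) volume 0 1)
    (hosc : ∀ s ∈ Icc (0 : ℝ) 1, ∀ t ∈ Icc (0 : ℝ) 1, |y s - y t| ≤ D)
    (hz : p * averagedMap B p z = p * (∫ s in (0 : ℝ)..1, y s) + ∫ s in (0 : ℝ)..1, B s (y s))
    {t : ℝ} (ht : t ∈ Icc (0 : ℝ) 1) : |y t - z| ≤ (p + β) / (p - β) * D := by
  have h := sub_mul_abs_sub_le hp hint hlip (y t) z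
  rw [hz, mul_averagedMap hp.ne'] at h
  have h1 : |∫ s in (0 : ℝ)..1, (y t - y s)| ≤ D :=
    abs_integral_le_of_abs_le fun s hs => hosc t ht s hs
  have h2 : |∫ s in (0 : ℝ)..1, (B s (y t) - B s (y s))| ≤ β * D :=
    abs_integral_le_of_abs_le fun s hs => (hlip s hs _ _).trans
      (mul_le_mul_of_nonneg_left (hosc t ht s hs) hβ)
  rw [intervalIntegral.integral_sub intervalIntegrable_const hyi] at h1
  rw [intervalIntegral.integral_sub (hint _) hBi] at h2
  simp only [intervalIntegral.integral_const, sub_zero, one_smul] at h1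
  rw [div_mul_eq_mul_div, le_div_iff₀ (sub_pos.2 hβp), mul_comm]
  refine h.trans ?_
  -- Cost of freezing the path at `y t`: the linear term contributes `p * D` and the perturbation `β
  -- * D`.
  have e : p * y t + (∫ s in (0 : ℝ)..1, B s (y t))
      - (p * (∫ s in (0 : ℝ)..1, y s) + ∫ s in (0 : ℝ)..1, B s (y s))
      = p * (y t - ∫ s in (0 : ℝ)..1, y s)
        + ((∫ s in (0 : ℝ)..1, B s (y t)) - ∫ s in (0 : ℝ)..1, B s (y s)) := by ring
  rw [e]
  refine (abs_add_le _ _).trans ?_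
  rw [abs_mul, abs_of_pos hp]
  have := mul_le_mul_of_nonneg_left h1 hp.le
  linarith

/-- The deterministic estimate: if a path `y` whose velocity vanishes somewhere solves the
integrated equation with a noise bounded by `m`, then it is `O(ε²)`-close to the solution `z` of
the averaged equation. -/
theorem abs_sub_le_of_integrated_eq (hA : ∀ t ∈ Icc (0 : ℝ) 1, ∀ x, A t x = p * x + B t x)
    (hp : 0 < p) (hβ : 0 ≤ β) (hβp : β < p)
    (hint : ∀ x, IntervalIntegrable (fun t => B t x) volume 0 1)
    (hb : ∀ t ∈ Icc (0 : ℝ) 1, ∀ x, |B t x| ≤ b)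
    (hlip : ∀ t ∈ Icc (0 : ℝ) 1, ∀ x y, |B t x - B t y| ≤ β * |x - y|)
    {f : ℝ → ℝ} (hf : IntervalIntegrable f volume 0 1)
    {y : ℝ → ℝ} (hy : ContDiffOn ℝ 1 y (Icc 0 1))
    (hi : IntervalIntegrable (fun s => A s (y s) + f s) volume 0 1)
    {ε m S : ℝ} (hε : 4 * ε ^ 2 * p ≤ 1)
    (hnoise : ∀ t ∈ Icc (0 : ℝ) 1, |derivWithin y (Icc 0 1) t - derivWithin y (Icc 0 1) 0
      - ε ^ 2 * ∫ s in (0 : ℝ)..t, (A s (y s) + f s)| ≤ ε ^ 2 * m)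
    (hS : |S| ≤ m) (htot : (∫ s in (0 : ℝ)..1, (A s (y s) + f s)) + S = 0)
    (hzero : ∃ t ∈ Icc (0 : ℝ) 1, derivWithin y (Icc 0 1) t = 0)
    {z : ℝ} (hz : p * averagedMap B p z = -(∫ s in (0 : ℝ)..1, f s) - S)
    {t : ℝ} (ht : t ∈ Icc (0 : ℝ) 1) :
    |y t - z| ≤
      ε ^ 2 * ((p + β) / (p - β) * (12 * ((∫ s in (0 : ℝ)..1, |f s|) + m + b))) := by
  set v := derivWithin y (Icc 0 1) with hv
  set F := ∫ s in (0 : ℝ)..1, |f s| with hF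
  have hvc : ContinuousOn v (Icc 0 1) :=
    hy.continuousOn_derivWithin (uniqueDiffOn_Icc zero_lt_one) le_rfl
  have hyi : IntervalIntegrable y volume 0 1 :=
    hy.continuousOn.intervalIntegrable_of_Icc zero_le_one
  -- `|v τ|` is the maximal speed; on an interval of length one it also bounds the oscillation of
  -- `y`.
  obtain ⟨τ, hτ, hmax⟩ := isCompact_Icc.exists_isMaxOn ⟨0, by simp⟩ hvc.abs
  have hD0 : 0 ≤ |v τ| := abs_nonneg _
  have hosc : ∀ s ∈ Icc (0 : ℝ) 1, ∀ t ∈ Icc (0 : ℝ) 1, |y s - y t| ≤ |v τ| := by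
    intro s hs t ht
    have := (convex_Icc (0 : ℝ) 1).norm_image_sub_le_of_norm_derivWithin_le
      (hy.differentiableOn one_ne_zero) (fun x hx => hmax hx) ht hs
    refine this.trans (mul_le_of_le_one_right hD0 ?_)
    rw [Real.norm_eq_abs, abs_le]
    constructor <;> linarith [hs.1, hs.2, ht.1, ht.2]
  -- Integrability along the path is read off from that of the drift, so no joint measurability of
  -- `B` is needed.
  have hBi : IntervalIntegrable (fun s => B s (y s)) volume 0 1 := by
    refine ((hi.sub hf).sub (hyi.const_mul p)).congr fun s hs => ?_
    rw [uIoc_of_le zero_le_one] at hs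
    simp only [hA s (Ioc_subset_Icc_self hs)]
    ring
  have hsplit : ∫ s in (0 : ℝ)..1, (A s (y s) + f s)
      = p * (∫ s in (0 : ℝ)..1, y s) + (∫ s in (0 : ℝ)..1, B s (y s))
        + ∫ s in (0 : ℝ)..1, f s := by
    rw [← intervalIntegral.integral_const_mul, ← intervalIntegral.integral_add (hyi.const_mul p) hBi,
      ← intervalIntegral.integral_add ((hyi.const_mul p).add hBi) hf]
    refine intervalIntegral.integral_congr fun s hs => ?_
    rw [uIcc_of_le zero_le_one] at hs
    simp only [hA s hs]
  have hfF : |∫ s in (0 : ℝ)..1, f s| ≤ F :=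
    intervalIntegral.abs_integral_le_integral_abs zero_le_one
  have hBb : |∫ s in (0 : ℝ)..1, B s (y s)| ≤ b :=
    abs_integral_le_of_abs_le fun s hs => hb s hs _
  -- The balance `htot` gives an a priori bound on the mean of `y`, hence on `y` up to its
  -- oscillation.
  have hmean : p * |∫ s in (0 : ℝ)..1, y s| ≤ F + m + b := by
    have e : p * |∫ s in (0 : ℝ)..1, y s| = |p * ∫ s in (0 : ℝ)..1, y s| := by
      rw [abs_mul, abs_of_pos hp]
    rw [e]
    rw [abs_le] at *
    constructor <;> linarith
  have hpy : ∀ s ∈ Icc (0 : ℝ) 1, p * |y s| ≤ F + m + b + p * |v τ| := by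
    intro s hs
    have h1 : |∫ r in (0 : ℝ)..1, (y s - y r)| ≤ |v τ| :=
      abs_integral_le_of_abs_le fun r hr => hosc s hs r hr
    rw [intervalIntegral.integral_sub intervalIntegrable_const hyi] at h1
    simp only [intervalIntegral.integral_const, sub_zero, one_smul] at h1
    have h2 := abs_sub_abs_le_abs_sub (y s) (∫ r in (0 : ℝ)..1, y r)
    have := mul_le_mul_of_nonneg_left (h2.trans h1) hp.le
    linarith
  have hG : ∫ s in (0 : ℝ)..1, |A s (y s) + f s| ≤ 2 * (F + m + b) + p * |v τ| := by
    have h1 : ∫ s in (0 : ℝ)..1, |A s (y s) + f s|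
        ≤ ∫ s in (0 : ℝ)..1, ((F + m + b + p * |v τ| + b) + |f s|) := by
      refine intervalIntegral.integral_mono_on zero_le_one hi.abs
        (intervalIntegrable_const.add hf.abs) fun s hs => ?_
      rw [hA s hs]
      have h2 := hpy s hs
      rw [show p * |y s| = |p * y s| by rw [abs_mul, abs_of_pos hp]] at h2
      have h3 := abs_add_le (p * y s + B s (y s)) (f s)
      have h4 := abs_add_le (p * y s) (B s (y s))
      have h5 := hb s hs (y s)
      linarith
    rw [intervalIntegral.integral_add intervalIntegrable_const hf.abs] at h1
    simp only [intervalIntegral.integral_const, sub_zero, one_smul] at h1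
    have hm : 0 ≤ m := (abs_nonneg _).trans hS
    linarith
  have hprim : ∀ r ∈ Icc (0 : ℝ) 1, |∫ s in (0 : ℝ)..r, (A s (y s) + f s)|
      ≤ 2 * (F + m + b) + p * |v τ| := fun r hr =>
    (intervalIntegral.abs_integral_le_integral_abs hr.1).trans <|
      (intervalIntegral.integral_mono_interval le_rfl hr.1 hr.2
        (ae_of_all _ fun s => abs_nonneg _) hi.abs).trans hG
  have hvel : ∀ r ∈ Icc (0 : ℝ) 1,
      |v r - v 0| ≤ ε ^ 2 * (2 * (F + m + b) + p * |v τ| + m) := by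
    intro r hr
    have h1 := hnoise r hr
    have h2 := mul_le_mul_of_nonneg_left (hprim r hr) (sq_nonneg ε)
    have h4 := abs_mul (ε ^ 2) (∫ s in (0 : ℝ)..r, (A s (y s) + f s))
    rw [abs_of_nonneg (sq_nonneg ε)] at h4
    have h3 := abs_add_le (v r - v 0 - ε ^ 2 * ∫ s in (0 : ℝ)..r, (A s (y s) + f s))
      (ε ^ 2 * ∫ s in (0 : ℝ)..r, (A s (y s) + f s))
    rw [sub_add_cancel] at h3
    linarith
  -- With `K = F + m + b`, going from `τ` to the zero of `v` through `0` gives `|v τ| ≤ 2 ε² (3 K +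
  -- p |v τ|)`. As `2 ε² p ≤ 1/2`, the last term is absorbed, which doubles `6` to `12`.
  have hD : |v τ| ≤ ε ^ 2 * (12 * (F + m + b)) := by
    obtain ⟨r, hr, hr0⟩ := hzero
    have h1 := hvel τ hτ
    have h2 := hvel r hr
    have h3 := abs_sub_le (v τ) (v 0) (v r)
    rw [hr0, zero_sub, abs_neg] at h2
    rw [hr0, sub_zero, sub_zero] at h3
    have hm : m ≤ F + m + b := by
      have := (abs_nonneg _).trans hfF
      have := (abs_nonneg _).trans hBb
      linarith
    have h4 := mul_le_mul_of_nonneg_right hε hD0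
    have h5 := mul_le_mul_of_nonneg_left hm (sq_nonneg ε)
    linarith
  refine (abs_sub_le_of_averaged_eq hp hβ hβp hint hlip hyi hBi hosc ?_ ht).trans ?_
  · linarith
  · rw [← mul_assoc, mul_comm (ε ^ 2), mul_assoc]
    exact mul_le_mul_of_nonneg_left hD
      (div_nonneg (add_nonneg hp.le hβ) (sub_nonneg.2 hβp.le))

end Averaging

/-- Rolle's theorem; at an interior point the one-sided and two-sided notions agree. -/
theorem exists_derivWithin_eq_zero {y : ℝ → ℝ} (hy : ContinuousOn y (Icc 0 1)) (h : y 0 = y 1) :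
    ∃ t ∈ Icc (0 : ℝ) 1, derivWithin y (Icc 0 1) t = 0 := by
  obtain ⟨c, hc, hc0⟩ := exists_deriv_eq_zero zero_lt_one hy h
  exact ⟨c, Ioo_subset_Icc_self hc, by
    rw [derivWithin_of_mem_nhds (Icc_mem_nhds hc.1 hc.2), hc0]⟩

/-! ### Control of the noise uniformly in `ε`. -/

section Noise

variable {Ω : Type*} [MeasurableSpace Ω] {P : Measure Ω} {W : I → Ω → ℝ}
  {A B : ℝ → ℝ → ℝ} {f δ : ℝ → ℝ} {p ε : ℝ} {x : ℝ → Ω → ℝ}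

theorem aemeasurable_stochInt (hW : IsBrownianUnit W P)
    (hδ : MemLp δ 2 (volume.restrict (Icc 0 1))) (t : ℝ) : AEMeasurable (stochInt W P δ t) P :=
  (isWienerIntegral_wienerIntegral hW (hδ.indicator measurableSet_Ioc)).1.aemeasurable

/-- The supremum of the indefinite stochastic integral over rational times. -/
noncomputable def noiseSup (W : I → Ω → ℝ) (P : Measure Ω) (δ : ℝ → ℝ) (ω : Ω) : ℝ≥0∞ :=
  ⨆ q : {q : ℚ // (q : ℝ) ∈ Icc (0 : ℝ) 1}, ‖stochInt W P δ (q : ℚ) ω‖ₑ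

/-- Rational times keep the supremum countable. -/
theorem aemeasurable_noiseSup (hW : IsBrownianUnit W P)
    (hδ : MemLp δ 2 (volume.restrict (Icc 0 1))) : AEMeasurable (noiseSup W P δ) P :=
  AEMeasurable.iSup fun q => (aemeasurable_stochInt hW hδ (q : ℚ)).enorm

theorem abs_stochInt_le {ω : Ω} (hM : noiseSup W P δ ω ≠ ⊤) {q : ℚ}
    (hq : (q : ℝ) ∈ Icc (0 : ℝ) 1) :
    |stochInt W P δ q ω| ≤ (noiseSup W P δ ω).toReal := by
  rw [← Real.norm_eq_abs, ← toReal_enorm]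
  exact ENNReal.toReal_mono hM
    (le_iSup (fun q : {q : ℚ // (q : ℝ) ∈ Icc (0 : ℝ) 1} => ‖stochInt W P δ (q : ℚ) ω‖ₑ) ⟨q, hq⟩)

/-- By density; it passes from countably many times, where the equation holds simultaneously almost
surely, to all times. -/
theorem abs_le_on_unit_of_rat {g : ℝ → ℝ} (hg : ContinuousOn g (Icc 0 1)) {C : ℝ}
    (h : ∀ q : ℚ, (q : ℝ) ∈ Icc (0 : ℝ) 1 → |g q| ≤ C) : ∀ t ∈ Icc (0 : ℝ) 1, |g t| ≤ C := by
  have hcl : Icc (0 : ℝ) 1 = closure (Ioo 0 1 ∩ range ((↑) : ℚ → ℝ)) := by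
    refine subset_antisymm ?_ (closure_minimal
      (inter_subset_left.trans Ioo_subset_Icc_self) isClosed_Icc)
    rw [← closure_Ioo zero_ne_one]
    exact closure_minimal (Rat.isDenseEmbedding_coe_real.dense.open_subset_closure_inter isOpen_Ioo)
      isClosed_closure
  intro t ht
  have hm : g t ∈ closure (g '' (Ioo 0 1 ∩ range ((↑) : ℚ → ℝ))) :=
    ContinuousOn.image_closure (hcl ▸ hg) (mem_image_of_mem g (hcl ▸ ht))
  refine closure_minimal (t := {a : ℝ | |a| ≤ C}) ?_
    (isClosed_le continuous_abs continuous_const) hm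
  rintro _ ⟨_, ⟨h1, q, rfl⟩, rfl⟩
  exact h q (Ioo_subset_Icc_self h1)

/-- What remains of the velocity increment after removing the drift. -/
noncomputable def noisePart (A : ℝ → ℝ → ℝ) (f : ℝ → ℝ) (ε : ℝ) (x : ℝ → Ω → ℝ) (t : ℝ) (ω : Ω) : ℝ :=
  velocity x t ω - velocity x 0 ω - ε ^ 2 * ∫ s in (0 : ℝ)..t, (A s (x s ω) + f s)

theorem IsSolution.continuousOn_noisePart (h : IsSolution W P A f δ ε x) :
    ∀ᵐ ω ∂P, ContinuousOn (fun t => noisePart A f ε x t ω) (Icc 0 1) := by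
  filter_upwards [h.contDiffOn, h.integrable] with ω h1 h2
  have h3 := h1.continuousOn_derivWithin (uniqueDiffOn_Icc zero_lt_one) le_rfl
  rw [intervalIntegrable_iff_integrableOn_Icc_of_le zero_le_one, ← uIcc_of_le zero_le_one] at h2
  have h4 := intervalIntegral.continuousOn_primitive_interval h2
  rw [uIcc_of_le zero_le_one] at h4
  exact (h3.sub continuousOn_const).sub (continuousOn_const.mul h4)

theorem IsSolution.noisePart_rat (h : IsSolution W P A f δ ε x) :
    ∀ᵐ ω ∂P, ∀ q : ℚ, (q : ℝ) ∈ Icc (0 : ℝ) 1 →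
      noisePart A f ε x q ω = ε ^ 2 * stochInt W P δ q ω := by
  rw [ae_all_iff]
  intro q
  by_cases hq : (q : ℝ) ∈ Icc (0 : ℝ) 1
  · filter_upwards [h.equation q hq] with ω hω _
    rw [noisePart, hω]
    ring
  · exact ae_of_all _ fun ω hq' => absurd hq' hq

/-- A solution for one `ε` provides a continuous version of the stochastic integral. -/
theorem IsSolution.noiseSup_ne_top (h : IsSolution W P A f δ ε x) (hε : 0 < ε) :
    ∀ᵐ ω ∂P, noiseSup W P δ ω ≠ ⊤ := by
  filter_upwards [h.continuousOn_noisePart, h.noisePart_rat] with ω h1 h2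
  obtain ⟨C, hC⟩ := isCompact_Icc.exists_bound_of_continuousOn h1
  refine ne_top_of_le_ne_top (b := ENNReal.ofReal (C / ε ^ 2)) ENNReal.ofReal_ne_top
    (iSup_le fun q => ?_)
  rw [← ofReal_norm]
  refine ENNReal.ofReal_le_ofReal ?_
  have := hC _ q.2
  rw [h2 _ q.2, norm_mul, Real.norm_of_nonneg (sq_nonneg ε)] at this
  rw [le_div_iff₀ (by positivity)]
  linarith

/-- The bounding variable does not involve `ε` or the solution, which makes the final estimate
uniform. -/
theorem IsSolution.abs_noisePart_le (h : IsSolution W P A f δ ε x) (hε : 0 < ε) :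
    ∀ᵐ ω ∂P, ∀ t ∈ Icc (0 : ℝ) 1,
      |noisePart A f ε x t ω| ≤ ε ^ 2 * (noiseSup W P δ ω).toReal := by
  filter_upwards [h.continuousOn_noisePart, h.noisePart_rat, h.noiseSup_ne_top hε] with ω h1 h2 h3
  refine abs_le_on_unit_of_rat h1 fun q hq => ?_
  rw [h2 q hq, abs_mul, abs_of_nonneg (sq_nonneg ε)]
  exact mul_le_mul_of_nonneg_left (abs_stochInt_le h3 hq) (sq_nonneg ε)

/-- Along any sequence `ε → 0+` the variables `ε² Z` tend to `0` pointwise, hence in measure. -/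
theorem tendsto_measure_le_sq_mul [IsFiniteMeasure P] {Z : Ω → ℝ} (hZ : AEMeasurable Z P)
    {r : ℝ} (hr : 0 < r) :
    Tendsto (fun ε : ℝ => P {ω | r ≤ ε ^ 2 * Z ω}) (𝓝[>] 0) (𝓝 0) := by
  refine tendsto_of_seq_tendsto fun u hu => ?_
  have hu0 : Tendsto u atTop (𝓝 0) := hu.mono_right nhdsWithin_le_nhds
  have h := tendstoInMeasure_of_tendsto_ae (μ := P) (f := fun n ω => u n ^ 2 * Z ω)
    (g := fun _ => 0) (fun n => (hZ.const_mul _).aestronglyMeasurable)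
    (ae_of_all _ fun ω => by simpa using (hu0.pow 2).mul_const (Z ω))
  refine tendsto_of_tendsto_of_tendsto_of_le_of_le tendsto_const_nhds
    (h (ENNReal.ofReal r) (by simpa)) (fun _ => zero_le) fun n => measure_mono fun ω hω => ?_
  simp only [mem_ofPred_eq] at hω ⊢
  rw [edist_zero_right, ← ofReal_norm]
  exact ENNReal.ofReal_le_ofReal (hω.trans (le_abs_self _))

/-- Convergence for all boundary conditions under which the velocity has equal boundary values and
vanishes somewhere. -/
theorem tendstoUnifInProb_of_velocity_eq_zero [IsProbabilityMeasure P] (hW : IsBrownianUnit W P)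
    (hA : IsBoundedPerturbation A B p) (hB : HasSmallDerivative B p)
    (hBmeas : ∀ x, AEMeasurable (fun t => B t x) (volume.restrict (Icc 0 1)))
    (hf : IntervalIntegrable f volume 0 1) (hδ : MemLp δ 2 (volume.restrict (Icc 0 1)))
    (hbij : Function.Bijective (averagedMap B p)) {x : ℝ → ℝ → Ω → ℝ}
    (hx : ∀ᶠ ε in 𝓝[>] (0 : ℝ), IsSolution W P A f δ ε (x ε) ∧
      ∀ᵐ ω ∂P, velocity (x ε) 0 ω = velocity (x ε) 1 ω ∧
        ∃ t ∈ Icc (0 : ℝ) 1, velocity (x ε) t ω = 0) :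
    TendstoUnifInProb P x (limitConstant W P B f δ p) := by
  obtain ⟨b, hb⟩ := hA.bounded
  obtain ⟨β, hβp, hβ⟩ := hB.bound
  have hβ0 : 0 ≤ β := (abs_nonneg _).trans (hβ 0 (by simp) 0)
  have hp := hA.pos
  have hint := fun x => intervalIntegrable_of_abs_le (hBmeas x) fun t ht => hb t ht x
  have hlip := fun t ht => abs_sub_le_of_abs_deriv_le (hB.differentiable t ht) (hβ t ht)
  intro r hr
  -- This is `Z`. Where `noiseSup` is infinite `toReal` returns `0`, harmless since that set is null
  -- once a solution exists.
  have hZ : AEMeasurable (fun ω => (p + β) / (p - β) *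
      (12 * ((∫ s in (0 : ℝ)..1, |f s|) + (noiseSup W P δ ω).toReal + b))) P :=
    ((((aemeasurable_noiseSup hW hδ).ennreal_toReal.const_add _).add_const _).const_mul _).const_mul _
  refine tendsto_of_tendsto_of_tendsto_of_le_of_le' tendsto_const_nhds
    (tendsto_measure_le_sq_mul hZ hr) (Eventually.of_forall fun _ => zero_le) ?_
  have hsmall : ∀ᶠ ε in 𝓝[>] (0 : ℝ), 4 * ε ^ 2 * p ≤ 1 := by
    have hc : Continuous fun ε : ℝ => 4 * ε ^ 2 * p := by fun_prop
    have := (hc.tendsto 0).mono_left (nhdsWithin_le_nhds (s := Ioi 0))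
    exact this.eventually_le_const (by simp)
  filter_upwards [hx, hsmall, self_mem_nhdsWithin] with ε ⟨hsol, hbc⟩ hε hε0
  refine measure_mono_ae ?_
  filter_upwards [hbc, hsol.contDiffOn, hsol.integrable, hsol.noisePart_rat,
    hsol.noiseSup_ne_top hε0, hsol.abs_noisePart_le hε0] with ω ⟨h01, hzero⟩ hcd hi hrat htop hle
  intro hω
  have hS : |stochInt W P δ 1 ω| ≤ (noiseSup W P δ ω).toReal := by
    simpa using abs_stochInt_le (q := 1) htop (by simp)
  -- Equal end velocities leave only terms carrying the factor `ε²`, which cancels.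
  have htot : (∫ s in (0 : ℝ)..1, (A s (x ε s ω) + f s)) + stochInt W P δ 1 ω = 0 := by
    have h1 := hrat 1 (by simp)
    rw [Rat.cast_one, noisePart, ← h01, sub_self, zero_sub] at h1
    have h2 : ε ^ 2 * ((∫ s in (0 : ℝ)..1, (A s (x ε s ω) + f s)) + stochInt W P δ 1 ω) = 0 := by
      linarith
    exact (mul_eq_zero.1 h2).resolve_left (pow_pos hε0 2).ne'
  have hz : p * averagedMap B p (limitConstant W P B f δ p ω)
      = -(∫ s in (0 : ℝ)..1, f s) - stochInt W P δ 1 ω := by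
    rw [limitConstant, Function.invFun_eq (hbij.2 _), limitDatum]
    field_simp
  have key := fun t ht => abs_sub_le_of_integrated_eq hA.decomp hp hβ0 hβp hint hb hlip hf hcd hi hε
    hle hS htot hzero hz (t := t) ht
  refine (ENNReal.ofReal_le_ofReal_iff ((abs_nonneg _).trans (key 0 (by simp)))).1
    (le_trans (show _ ≤ _ from hω) (iSup₂_le fun t ht => ?_))
  rw [← ofReal_norm]
  exact ENNReal.ofReal_le_ofReal (key t ht)

end Noise

/-! ### Neumann and periodic boundary conditions. -/

theorem theorem3p2 {Ω : Type*} [MeasurableSpace Ω] (P : Measure Ω) [IsProbabilityMeasure P]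
    (W : I → Ω → ℝ) (hW : IsBrownianUnit W P)
    (A B : ℝ → ℝ → ℝ) (p : ℝ)
    (hA : IsBoundedPerturbation A B p) (hB : HasSmallDerivative B p)
    (hBmeas : ∀ x, AEMeasurable (fun t => B t x) (volume.restrict (Icc 0 1)))
    (f : ℝ → ℝ) (hf : IntervalIntegrable f volume 0 1)
    (δ : ℝ → ℝ) (hδ : MemLp δ 2 (volume.restrict (Icc 0 1))) :
    Function.Bijective (averagedMap B p) ∧
    (∀ x : ℝ → ℝ → Ω → ℝ,
      (∀ᶠ ε in 𝓝[>] (0 : ℝ), IsSolution W P A f δ ε (x ε) ∧ NeumannBC P (x ε)) →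
      TendstoUnifInProb P x (limitConstant W P B f δ p)) ∧
    (∀ x : ℝ → ℝ → Ω → ℝ,
      (∀ᶠ ε in 𝓝[>] (0 : ℝ), IsSolution W P A f δ ε (x ε) ∧ PeriodicBC P (x ε)) →
      TendstoUnifInProb P x (limitConstant W P B f δ p)) := by
  obtain ⟨b, hb⟩ := hA.bounded
  obtain ⟨β, hβp, hβ⟩ := hB.bound
  have hbij := averagedMap_bijective hA.pos hβp
    (fun x => intervalIntegrable_of_abs_le (hBmeas x) fun t ht => hb t ht x) hb
    (fun t ht => abs_sub_le_of_abs_deriv_le (hB.differentiable t ht) (hβ t ht))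
  refine ⟨hbij, fun x hx => ?_, fun x hx => ?_⟩
  · refine tendstoUnifInProb_of_velocity_eq_zero hW hA hB hBmeas hf hδ hbij
      (hx.mono fun ε ⟨hsol, hbc⟩ => ⟨hsol, ?_⟩)
    filter_upwards [hbc] with ω hω
    exact ⟨hω.1.trans hω.2.symm, 0, by simp, hω.1⟩
  · refine tendstoUnifInProb_of_velocity_eq_zero hW hA hB hBmeas hf hδ hbij
      (hx.mono fun ε ⟨hsol, hbc⟩ => ⟨hsol, ?_⟩)
    filter_upwards [hbc, hsol.contDiffOn] with ω hω hcd
    exact ⟨hω.2, exists_derivWithin_eq_zero hcd.continuousOn hω.1⟩
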